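/- Let $(M,g)$ be a smooth Hausdorff Riemannian manifold of finite dimension $n$ with Levi-Civita connection $\nabla$ and Christoffel symbols $\Gamma^j_{rs}$. For $(x,u)\in TM$ and $X\in T_xM$ let $$X^h=X^j\frac{\partial}{\partial x^j}-u^rX^s\Gamma^j_{rs}\frac{\partial}{\partial u^j},\qquad X^v=X^j\frac{\partial}{\partial u^j}$$ be the horizontal and vertical lifts of $X$ to $(x,u)$. Let $a_1,a_2,a_3,b_1,b_2,b_3:[0,\infty)\to\mathbb R$ be smooth, put $A=a_1+a_3$, $B=b_1+b_3$, and let $G$ be the $g$-natural metric on $TM$ with these coefficients, i.e. the symmetric $(0,2)$-tensor field determined, with $r^2=g_x(u,u)$, by $$\begin{aligned} G_{(x,u)}(X^h,Y^h)&=A(r^2)\,g_x(X,Y)+B(r^2)\,g_x(X,u)g_x(Y,u),\\ G_{(x,u)}(X^h,Y^v)=G_{(x,u)}(X^v,Y^h)&=a_2(r^2)\,g_x(X,Y)+b_2(r^2)\,g_x(X,u)g_x(Y,u),\\ G_{(x,u)}(X^v,Y^v)&=a_1(r^2)\,g_x(X,Y)+b_1(r^2)\,g_x(X,u)g_x(Y,u).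 \end{aligned}$$ **Theorem.** Suppose $a_2(t)=b_2(t)=B(t)=0$ for all $t\ge 0$. Let $P$ be a smooth $(0,2)$-tensor field on $M$ that is skew-symmetric, $P(X,Y)=-P(Y,X)$, and parallel, $\nabla P=0$. Then its $\iota$-lift $$\iota P=u^rP_r^a\,\partial_a^v,\qquad P_r^a=g^{at}P_{tr},\quad \partial_a^v=\Big(\frac{\partial}{\partial x^a}\Big)^v,$$ is a Killing vector field on $(TM,G)$: it is a smooth vector field on $TM$ and $L_{\iota P}G=0$. (Non-degeneracy of $G$ and $P\neq 0$ are not needed.) -/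

import Mathlib

open Bundle Set
open scoped Manifold ContDiff

noncomputable section

/-! Throughout, `M` is a smooth manifold modelled on a finite-dimensional real vector space `E`.
In Mathlib the tangent space `T_x M` is the vector space `E`: a vector is identified with its
components in the preferred chart `extChartAt 𝓘(ℝ, E) x` around `x`.  In the same way the tangent
space of `TM` at `p = (x, u)` is `E × E`: a vector is identified with its components `(ẋ, u̇)`
in the chart `(xʲ, uʲ)` of `TM` induced by the preferred chart around `x`. -/

namespace TangentBundleGeometry

section LieDerivative

variable {F : Type*} [NormedAddCommGroup F] [NormedSpace ℝ F]
  {H : Type*} [TopologicalSpace H] (I : ModelWithCorners ℝ F H)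
  {N : Type*} [TopologicalSpace N] [ChartedSpace H N] [IsManifold I 1 N]

/-- The Lie derivative of a `(0,2)`-tensor field `G` along a vector field `Z`, evaluated on the
vector fields `V`, `W` at `p`: `(L_Z G)(V, W) = Z(G(V, W)) - G([Z, V], W) - G(V, [Z, W])`. -/
def lieDerivTensor (Z : Π p : N, TangentSpace I p)
    (G : Π p : N, TangentSpace I p →L[ℝ] TangentSpace I p →L[ℝ] ℝ)
    (V W : Π p : N, TangentSpace I p) (p : N) : ℝ :=
  mvfderiv I (fun q : N => G q (V q) (W q)) p (Z p)
    - G p (VectorField.mlieBracket I Z V p) (W p)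
    - G p (V p) (VectorField.mlieBracket I Z W p)

/-- `Z` is a Killing vector field for the `(0,2)`-tensor field `G`: it is a smooth vector field
and `L_Z G = 0`. -/
structure IsKillingField (G : Π p : N, TangentSpace I p →L[ℝ] TangentSpace I p →L[ℝ] ℝ)
    (Z : Π p : N, TangentSpace I p) : Prop where
  smooth : ContMDiff I I.tangent ∞ (fun p : N => (⟨p, Z p⟩ : TangentBundle I N))
  lieDeriv_eq_zero : ∀ (p : N) (V W : Π q : N, TangentSpace I q),
    MDifferentiableAt I I.tangent (fun q : N => (⟨q, V q⟩ : TangentBundle I N)) p →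
    MDifferentiableAt I I.tangent (fun q : N => (⟨q, W q⟩ : TangentBundle I N)) p →
    lieDerivTensor I Z G V W p = 0

end LieDerivative

variable {E : Type*} [NormedAddCommGroup E] [NormedSpace ℝ E]
  {M : Type*} [TopologicalSpace M] [ChartedSpace E M]

/-- The components of a `(0,2)`-tensor field in the preferred chart around `x₀`: the bilinear
form `(v, w) ↦ T(vⁱ∂ᵢ, wʲ∂ⱼ)` at the point with coordinates `y`. -/
def tensorInChart (T : Π x : M, TangentSpace 𝓘(ℝ, E) x →L[ℝ] TangentSpace 𝓘(ℝ, E) x →L[ℝ] ℝ)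
    (x₀ : M) (y : E) : E →L[ℝ] E →L[ℝ] ℝ :=
  let Ty : E →L[ℝ] E →L[ℝ] ℝ := T ((extChartAt 𝓘(ℝ, E) x₀).symm y)
  let Dφ : E →L[ℝ] E := mfderiv 𝓘(ℝ, E) 𝓘(ℝ, E) (extChartAt 𝓘(ℝ, E) x₀).symm y
  Ty.bilinearComp Dφ Dφ

/-- A smooth `(0,2)`-tensor field on `M`. -/
def IsSmoothTensor [IsManifold 𝓘(ℝ, E) ∞ M]
    (T : Π x : M, TangentSpace 𝓘(ℝ, E) x →L[ℝ] TangentSpace 𝓘(ℝ, E) x →L[ℝ] ℝ) : Prop :=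
  ContMDiff 𝓘(ℝ, E) (𝓘(ℝ, E).prod 𝓘(ℝ, E →L[ℝ] E →L[ℝ] ℝ)) ∞
    (fun x : M => TotalSpace.mk' (E →L[ℝ] E →L[ℝ] ℝ)
      (E := fun x : M => TangentSpace 𝓘(ℝ, E) x →L[ℝ] TangentSpace 𝓘(ℝ, E) x →L[ℝ] ℝ) x (T x))

variable [IsManifold 𝓘(ℝ, E) ∞ M]
  (g : ContMDiffRiemannianMetric 𝓘(ℝ, E) ∞ E (fun x : M => TangentSpace 𝓘(ℝ, E) x))

/-- Raising an index: the inverse of `T_x M → T_x^* M`, `v ↦ g(v, ·)`. -/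
def sharp (x : M) : (TangentSpace 𝓘(ℝ, E) x →L[ℝ] ℝ) →L[ℝ] TangentSpace 𝓘(ℝ, E) x :=
  (g.inner x).inverse

/-- The Christoffel symbols at `x` of the Levi-Civita connection, in the preferred chart around
`x`: `Γ(v, w)` is the vector with
`g(Γ(v, w), z) = (1/2) (∂_v g(w, z) + ∂_w g(v, z) - ∂_z g(v, w))` for all `z`. -/
def christoffel (x : M) (v : TangentSpace 𝓘(ℝ, E) x) :
    TangentSpace 𝓘(ℝ, E) x →L[ℝ] TangentSpace 𝓘(ℝ, E) x :=
  let D := fderiv ℝ (tensorInChart g.inner x) (extChartAt 𝓘(ℝ, E) x x)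
  let koszul := (1 / 2 : ℝ) • (D v + D.flip v - (D.flip v).flip)
  let raise : (E →L[ℝ] ℝ) →L[ℝ] E := sharp g x
  raise ∘L koszul

/-- The covariant derivative of a `(0,2)`-tensor field for the Levi-Civita connection:
`(∇_v T)(w, z) = ∂_v T(w, z) - T(Γ(v, w), z) - T(w, Γ(v, z))`. -/
def covDerivTensor
    (T : Π x : M, TangentSpace 𝓘(ℝ, E) x →L[ℝ] TangentSpace 𝓘(ℝ, E) x →L[ℝ] ℝ)
    (x : M) (v w z : TangentSpace 𝓘(ℝ, E) x) : ℝ :=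
  fderiv ℝ (tensorInChart T x) (extChartAt 𝓘(ℝ, E) x x) v w z
    - T x (christoffel g x v w) z - T x w (christoffel g x v z)

/-- `∇T = 0`. -/
def IsParallel
    (T : Π x : M, TangentSpace 𝓘(ℝ, E) x →L[ℝ] TangentSpace 𝓘(ℝ, E) x →L[ℝ] ℝ) : Prop :=
  ∀ (x : M) (v w z : TangentSpace 𝓘(ℝ, E) x), covDerivTensor g T x v w z = 0

/-- The vertical lift `X^v = Xʲ ∂/∂uʲ` of `X ∈ T_x M` to the point `p = (x, u)`. -/
def verticalLift (p : TangentBundle 𝓘(ℝ, E) M) (X : TangentSpace 𝓘(ℝ, E) p.1) :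
    TangentSpace 𝓘(ℝ, E).tangent p :=
  ((0, X) : E × E)

/-- The horizontal lift `X^h = Xʲ ∂/∂xʲ - uʳ Xˢ Γʲ_{rs} ∂/∂uʲ` of `X ∈ T_x M` to the point
`p = (x, u)`. -/
def horizontalLift (p : TangentBundle 𝓘(ℝ, E) M) (X : TangentSpace 𝓘(ℝ, E) p.1) :
    TangentSpace 𝓘(ℝ, E).tangent p :=
  ((X, -christoffel g p.1 p.2 X) : E × E)

/-- The differential `dπ : T_{(x,u)} TM → T_x M`, `(ẋ, u̇) ↦ ẋ`, of the projection. -/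
def dproj (p : TangentBundle 𝓘(ℝ, E) M) :
    TangentSpace 𝓘(ℝ, E).tangent p →L[ℝ] TangentSpace 𝓘(ℝ, E) p.1 :=
  ContinuousLinearMap.fst ℝ E E

/-- The connection map `K : T_{(x,u)} TM → T_x M`, `(ẋ, u̇) ↦ u̇ + Γ(u, ẋ)`. -/
def connectionMap (p : TangentBundle 𝓘(ℝ, E) M) :
    TangentSpace 𝓘(ℝ, E).tangent p →L[ℝ] TangentSpace 𝓘(ℝ, E) p.1 :=
  let Γ : E →L[ℝ] E := christoffel g p.1 p.2
  (ContinuousLinearMap.snd ℝ E E + Γ ∘L ContinuousLinearMap.fst ℝ E E : E × E →L[ℝ] E)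

/-- The six smooth coefficient functions `[0, ∞) → ℝ` of a `g`-natural metric (the values at
negative numbers play no role). -/
structure NaturalCoefficients where
  (a₁ a₂ a₃ b₁ b₂ b₃ : ℝ → ℝ)
  smooth_a₁ : ContDiffOn ℝ ∞ a₁ (Ici 0)
  smooth_a₂ : ContDiffOn ℝ ∞ a₂ (Ici 0)
  smooth_a₃ : ContDiffOn ℝ ∞ a₃ (Ici 0)
  smooth_b₁ : ContDiffOn ℝ ∞ b₁ (Ici 0)
  smooth_b₂ : ContDiffOn ℝ ∞ b₂ (Ici 0)
  smooth_b₃ : ContDiffOn ℝ ∞ b₃ (Ici 0)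

/-- `A = a₁ + a₃`. -/
def NaturalCoefficients.A (c : NaturalCoefficients) (t : ℝ) : ℝ := c.a₁ t + c.a₃ t

/-- `B = b₁ + b₃`. -/
def NaturalCoefficients.B (c : NaturalCoefficients) (t : ℝ) : ℝ := c.b₁ t + c.b₃ t

/-- The `g`-natural metric `G` on `TM` with coefficients `a₁, a₂, a₃, b₁, b₂, b₃`; its values on
horizontal and vertical lifts are computed in lemmas below.  Here `r² = g(u, u)`, `D = dπ`,
`uD = g(u, dπ ·)` and `uK = g(u, K ·)`. -/
def naturalMetric (c : NaturalCoefficients) (p : TangentBundle 𝓘(ℝ, E) M) :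
    TangentSpace 𝓘(ℝ, E).tangent p →L[ℝ] TangentSpace 𝓘(ℝ, E).tangent p →L[ℝ] ℝ :=
  let r2 : ℝ := g.inner p.1 p.2 p.2
  let gx : E →L[ℝ] E →L[ℝ] ℝ := g.inner p.1
  let D : E × E →L[ℝ] E := dproj p
  let K : E × E →L[ℝ] E := connectionMap g p
  let uD : E × E →L[ℝ] ℝ := gx p.2 ∘L D
  let uK : E × E →L[ℝ] ℝ := gx p.2 ∘L K
  let G : E × E →L[ℝ] E × E →L[ℝ] ℝ :=
    c.A r2 • gx.bilinearComp D D + c.B r2 • uD.smulRight uD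
      + c.a₂ r2 • (gx.bilinearComp D K + gx.bilinearComp K D)
      + c.b₂ r2 • (uD.smulRight uK + uK.smulRight uD)
      + c.a₁ r2 • gx.bilinearComp K K + c.b₁ r2 • uK.smulRight uK
  G

/-- The `ι`-lift `uʳ P_rᵃ ∂ₐ^v` of a `(0,2)`-tensor field `P`, where `P_rᵃ = g^{at} P_{tr}`. -/
def iotaLift (P : Π x : M, TangentSpace 𝓘(ℝ, E) x →L[ℝ] TangentSpace 𝓘(ℝ, E) x →L[ℝ] ℝ)
    (p : TangentBundle 𝓘(ℝ, E) M) : TangentSpace 𝓘(ℝ, E).tangent p :=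
  let Px : E →L[ℝ] E →L[ℝ] ℝ := P p.1
  verticalLift p (sharp g p.1 (Px.flip p.2))

/-! Consistency of the definitions. -/

theorem inner_sharp [FiniteDimensional ℝ E] (x : M) (α : TangentSpace 𝓘(ℝ, E) x →L[ℝ] ℝ)
    (w : TangentSpace 𝓘(ℝ, E) x) : g.inner x (sharp g x α) w = α w := by
  let gx : E →L[ℝ] E →L[ℝ] ℝ := g.inner x
  have hinj : Function.Injective (gx.toLinearMap) := by
    rw [injective_iff_map_eq_zero]
    intro v hv
    by_contra hne
    have h1 := g.pos x v hne
    have h2 : gx v v = 0 := by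
      have : gx v = 0 := hv
      rw [this]; rfl
    exact h1.ne' h2
  have hdim : Module.finrank ℝ E = Module.finrank ℝ (E →L[ℝ] ℝ) := by
    rw [← (LinearMap.toContinuousLinearMap (𝕜 := ℝ) (E := E) (F' := ℝ)).finrank_eq]
    exact (Subspace.dual_finrank_eq (K := ℝ) (V := E)).symm
  let e : E ≃L[ℝ] (E →L[ℝ] ℝ) :=
    (LinearEquiv.ofInjectiveOfFinrankEq gx.toLinearMap hinj hdim).toContinuousLinearEquiv
  have he : (e : E →L[ℝ] (E →L[ℝ] ℝ)) = gx := by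
    ext v w
    rfl
  have hs : gx.inverse = (e.symm : (E →L[ℝ] ℝ) →L[ℝ] E) := by
    rw [← he, ContinuousLinearMap.inverse_equiv]
  have : gx (gx.inverse α) = α := by
    rw [hs]
    exact e.apply_symm_apply α
  exact congrArg (fun β : E →L[ℝ] ℝ => β w) this

theorem inner_christoffel [FiniteDimensional ℝ E] (x : M) (v w z : TangentSpace 𝓘(ℝ, E) x) :
    g.inner x (christoffel g x v w) z
      = (1 / 2 : ℝ) * (fderiv ℝ (tensorInChart g.inner x) (extChartAt 𝓘(ℝ, E) x x) v w z
        + fderiv ℝ (tensorInChart g.inner x) (extChartAt 𝓘(ℝ, E) x x) w v z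
        - fderiv ℝ (tensorInChart g.inner x) (extChartAt 𝓘(ℝ, E) x x) z v w) :=
  inner_sharp g x _ z

section
variable (c : NaturalCoefficients) (p : TangentBundle 𝓘(ℝ, E) M) (X Y : TangentSpace 𝓘(ℝ, E) p.1)

theorem dproj_horizontalLift : dproj p (horizontalLift g p X) = X := rfl

theorem dproj_verticalLift : dproj p (verticalLift p X) = 0 := rfl

theorem connectionMap_horizontalLift : connectionMap g p (horizontalLift g p X) = 0 :=
  neg_add_cancel _

theorem connectionMap_verticalLift : connectionMap g p (verticalLift p X) = X := by
  change X + christoffel g p.1 p.2 0 = X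
  rw [map_zero, add_zero]

theorem naturalMetric_apply (ξ η : TangentSpace 𝓘(ℝ, E).tangent p) :
    naturalMetric g c p ξ η
      = c.A (g.inner p.1 p.2 p.2) * g.inner p.1 (dproj p ξ) (dproj p η)
        + c.B (g.inner p.1 p.2 p.2)
          * (g.inner p.1 p.2 (dproj p ξ) * g.inner p.1 p.2 (dproj p η))
        + c.a₂ (g.inner p.1 p.2 p.2)
          * (g.inner p.1 (dproj p ξ) (connectionMap g p η)
            + g.inner p.1 (connectionMap g p ξ) (dproj p η))
        + c.b₂ (g.inner p.1 p.2 p.2)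
          * (g.inner p.1 p.2 (dproj p ξ) * g.inner p.1 p.2 (connectionMap g p η)
            + g.inner p.1 p.2 (connectionMap g p ξ) * g.inner p.1 p.2 (dproj p η))
        + c.a₁ (g.inner p.1 p.2 p.2)
          * g.inner p.1 (connectionMap g p ξ) (connectionMap g p η)
        + c.b₁ (g.inner p.1 p.2 p.2)
          * (g.inner p.1 p.2 (connectionMap g p ξ) * g.inner p.1 p.2 (connectionMap g p η)) :=
  rfl

theorem naturalMetric_hh :
    naturalMetric g c p (horizontalLift g p X) (horizontalLift g p Y)
      = (c.a₁ + c.a₃) (g.inner p.1 p.2 p.2) * g.inner p.1 X Y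
        + (c.b₁ + c.b₃) (g.inner p.1 p.2 p.2) * (g.inner p.1 X p.2 * g.inner p.1 Y p.2) := by
  simp only [naturalMetric_apply, dproj_horizontalLift, connectionMap_horizontalLift, g.symm p.1 p.2,
    map_zero, zero_apply, NaturalCoefficients.A, NaturalCoefficients.B, Pi.add_apply]
  ring

theorem naturalMetric_hv :
    naturalMetric g c p (horizontalLift g p X) (verticalLift p Y)
      = c.a₂ (g.inner p.1 p.2 p.2) * g.inner p.1 X Y
        + c.b₂ (g.inner p.1 p.2 p.2) * (g.inner p.1 X p.2 * g.inner p.1 Y p.2) := by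
  simp only [naturalMetric_apply, dproj_horizontalLift, connectionMap_horizontalLift,
    dproj_verticalLift, connectionMap_verticalLift, g.symm p.1 p.2, map_zero, zero_apply]
  ring

theorem naturalMetric_vh :
    naturalMetric g c p (verticalLift p X) (horizontalLift g p Y)
      = c.a₂ (g.inner p.1 p.2 p.2) * g.inner p.1 X Y
        + c.b₂ (g.inner p.1 p.2 p.2) * (g.inner p.1 X p.2 * g.inner p.1 Y p.2) := by
  simp only [naturalMetric_apply, dproj_horizontalLift, connectionMap_horizontalLift,
    dproj_verticalLift, connectionMap_verticalLift, g.symm p.1 p.2, map_zero, zero_apply]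
  ring

theorem naturalMetric_vv :
    naturalMetric g c p (verticalLift p X) (verticalLift p Y)
      = c.a₁ (g.inner p.1 p.2 p.2) * g.inner p.1 X Y
        + c.b₁ (g.inner p.1 p.2 p.2) * (g.inner p.1 X p.2 * g.inner p.1 Y p.2) := by
  simp only [naturalMetric_apply, dproj_verticalLift, connectionMap_verticalLift, g.symm p.1 p.2, map_zero, zero_apply]
  ring

end

theorem inner_connectionMap_iotaLift [FiniteDimensional ℝ E]
    (P : Π x : M, TangentSpace 𝓘(ℝ, E) x →L[ℝ] TangentSpace 𝓘(ℝ, E) x →L[ℝ] ℝ)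
    (p : TangentBundle 𝓘(ℝ, E) M) (w : TangentSpace 𝓘(ℝ, E) p.1) :
    g.inner p.1 (connectionMap g p (iotaLift g P p)) w = P p.1 w p.2 := by
  have h : connectionMap g p (iotaLift g P p)
      = sharp g p.1 (ContinuousLinearMap.flip (E := E) (F := E) (P p.1) p.2) :=
    connectionMap_verticalLift g p _
  rw [h]
  exact inner_sharp g p.1 _ w

end TangentBundleGeometry

end

/-! Write S = g⁻¹P for the endomorphism obtained by raising an index of P. On each fibre the ι-lift
is the linear field u ↦ Su, and its flow is u ↦ exp(tS)u. Skew-symmetry of P makes S skew for g, so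
the flow rotates the fibres and preserves g(u,u), hence all coefficients evaluated at it.
Parallelism makes the flow respect the horizontal distribution: dπ is unchanged and the connection
map K is composed with exp(tS). With a₂ = b₂ = B = 0 the metric is A g(dπ,dπ) + a₁ g(K,K) + b₁
g(u,K)g(u,K), and every term is invariant. The excluded terms pair a rotated vector (u or K) with
the unrotated dπ.

The proof is the infinitesimal version, in the chart of TM centred at a point.
`lieDerivTensor_eq_chart` reduces the Lie derivative to calculus in E × E.
`tangentCoordChange_connectionMap` shows that K, defined with a different chart at each point, is
represented by a single formula in a fixed chart. `fderiv_raisedTensorInChart_of_isParallel` turns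
∇P = 0 into a formula for DS, and `naturalMetricInChart_lieDeriv_eq_zero` carries out the
cancellation. -/

noncomputable section

open Filter Topology

namespace TangentBundleGeometry

/-! ### Lie brackets and Lie derivatives in a chart. -/

section ChartRepresentation

variable {F : Type*} [NormedAddCommGroup F] [NormedSpace ℝ F]
  {H : Type*} [TopologicalSpace H] {I : ModelWithCorners ℝ F H}
  {N : Type*} [TopologicalSpace N] [ChartedSpace H N] [IsManifold I 1 N]

theorem tangentCoordChange_base (p : N) (v : F) : tangentCoordChange I p p p v = v :=
  tangentCoordChange_self (mem_extChartAt_source p)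

theorem mfderiv_extChartAt_eq {p q : N} (hq : q ∈ (extChartAt I p).source) :
    (mfderiv I 𝓘(ℝ, F) (extChartAt I p) q : F →L[ℝ] F) = tangentCoordChange I q p q := by
  rw [extChartAt_source] at hq
  exact (TangentBundle.continuousLinearMapAt_trivializationAt hq).symm.trans
    (TangentBundle.continuousLinearMapAt_trivializationAt_eq_core hq)

/-- The components of a vector field in the preferred chart around `p`. -/
def vectorInChart (I : ModelWithCorners ℝ F H) {N : Type*} [TopologicalSpace N] [ChartedSpace H N]
    [IsManifold I 1 N] (V : Π q : N, TangentSpace I q) (p : N) (y : F) : F :=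
  tangentCoordChange I ((extChartAt I p).symm y) p ((extChartAt I p).symm y)
    (V ((extChartAt I p).symm y))

theorem vectorInChart_extChartAt (V : Π q : N, TangentSpace I q) {p q : N}
    (hq : q ∈ (extChartAt I p).source) :
    vectorInChart I V p (extChartAt I p q) = tangentCoordChange I q p q (V q) := by
  -- The point is generalised because V takes values in a type depending on it, which blocks direct
  -- rewriting.
  have h (q' : N) (e : q' = q) :
      tangentCoordChange I q' p q' (V q') = tangentCoordChange I q p q (V q) := by rw [e]
  exact h _ ((extChartAt I p).left_inv hq)

theorem vectorInChart_base (V : Π q : N, TangentSpace I q) (p : N) :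
    vectorInChart I V p (extChartAt I p p) = V p := by
  rw [vectorInChart_extChartAt V (mem_extChartAt_source p)]
  exact tangentCoordChange_base p _

theorem mpullback_extChartAt_symm (V : Π q : N, TangentSpace I q) {p : N} {y : F}
    (hy : y ∈ (extChartAt I p).target) :
    VectorField.mpullbackWithin 𝓘(ℝ, F) I (extChartAt I p).symm V (range I) y
      = vectorInChart I V p y := by
  rw [VectorField.mpullbackWithin_apply, ContinuousLinearMap.inverse_eq
    (mfderivWithin_extChartAt_symm_comp_mfderiv_extChartAt hy)
    (mfderiv_extChartAt_comp_mfderivWithin_extChartAt_symm hy)]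
  exact congrArg (fun L : F →L[ℝ] F => L (V ((extChartAt I p).symm y)))
    (mfderiv_extChartAt_eq ((extChartAt I p).map_target hy))

/-- The bracket is computed in the chart and pulled back by the derivative of the chart at its
centre, which is the identity under the identification of T_pN with F. -/
theorem mlieBracket_eq_lieBracket [I.Boundaryless] (V W : Π q : N, TangentSpace I q) (p : N) :
    VectorField.mlieBracket I V W p
      = VectorField.lieBracket ℝ (vectorInChart I V p) (vectorInChart I W p)
        (extChartAt I p p) := by
  have ht : (extChartAt I p).target ∈ 𝓝 (extChartAt I p p) := extChartAt_target_mem_nhds p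
  have h (U : Π q : N, TangentSpace I q) :
      VectorField.mpullbackWithin 𝓘(ℝ, F) I (extChartAt I p).symm U (range I)
        =ᶠ[𝓝 (extChartAt I p p)] vectorInChart I U p := by
    filter_upwards [ht] with y hy using mpullback_extChartAt_symm U hy
  have hi : (mfderiv I 𝓘(ℝ, F) (extChartAt I p) p : F →L[ℝ] F).inverse
      = ContinuousLinearMap.id ℝ F := by
    have h1 (L : F →L[ℝ] F) (hL : L = ContinuousLinearMap.id ℝ F) :
        L.inverse = ContinuousLinearMap.id ℝ F := by rw [hL, ContinuousLinearMap.inverse_id]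
    exact h1 _ mfderiv_extChartAt_self
  rw [← VectorField.mlieBracketWithin_univ, VectorField.mlieBracketWithin_apply]
  refine (congrArg (fun L : F →L[ℝ] F => L _) hi).trans ?_
  rw [preimage_univ, univ_inter, I.range_eq_univ]
  refine (congrFun (VectorField.lieBracketWithin_univ (𝕜 := ℝ) (E := F)) _).trans ?_
  simp only [I.range_eq_univ] at h
  exact (h V).lieBracket_vectorField_eq (h W)

theorem differentiableAt_vectorInChart [I.Boundaryless] {V : Π q : N, TangentSpace I q} {p : N}
    (hV : MDifferentiableAt I I.tangent (fun q : N => (⟨q, V q⟩ : TangentBundle I N)) p) :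
    DifferentiableAt ℝ (vectorInChart I V p) (extChartAt I p p) := by
  have h1 := (mdifferentiableAt_section I V).1 hV
  have h2 : MDifferentiableAt 𝓘(ℝ, F) I (extChartAt I p).symm (extChartAt I p p) := by
    have := mdifferentiableWithinAt_extChartAt_symm (mem_extChartAt_target (I := I) p)
    rwa [I.range_eq_univ, mdifferentiableWithinAt_univ] at this
  have h3 := MDifferentiableAt.comp (extChartAt I p p) (I' := I)
    (g := fun q => (trivializationAt F (TangentSpace I) p ⟨q, V q⟩).2)
    (by rw [extChartAt_to_inv]; exact h1) h2
  exact h3.differentiableAt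

/-- Coordinate changes are the identity at the centre of the chart, so the values of the fields at p
enter unchanged. Elsewhere Γ must absorb the change from the preferred chart at q to the one at p.
-/
theorem lieDerivTensor_eq_chart [I.Boundaryless] {Z V W : Π q : N, TangentSpace I q}
    {G : Π q : N, TangentSpace I q →L[ℝ] TangentSpace I q →L[ℝ] ℝ} {p : N} {Γ : F → F → F → ℝ}
    (hG : ∀ q ∈ (extChartAt I p).source, ∀ ξ η : TangentSpace I q, G q ξ η
      = Γ (extChartAt I p q) (tangentCoordChange I q p q ξ) (tangentCoordChange I q p q η))
    (hd : DifferentiableAt ℝ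
      (fun y => Γ y (vectorInChart I V p y) (vectorInChart I W p y)) (extChartAt I p p)) :
    lieDerivTensor I Z G V W p
      = fderiv ℝ (fun y => Γ y (vectorInChart I V p y) (vectorInChart I W p y))
          (extChartAt I p p) (Z p)
        - Γ (extChartAt I p p) (VectorField.lieBracket ℝ (vectorInChart I Z p)
            (vectorInChart I V p) (extChartAt I p p)) (W p)
        - Γ (extChartAt I p p) (V p) (VectorField.lieBracket ℝ (vectorInChart I Z p)
            (vectorInChart I W p) (extChartAt I p p)) := by
  have hp := mem_extChartAt_source (I := I) p
  have hf : (fun q : N => G q (V q) (W q)) =ᶠ[𝓝 p]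
      (fun y => Γ y (vectorInChart I V p y) (vectorInChart I W p y)) ∘ extChartAt I p := by
    filter_upwards [extChartAt_source_mem_nhds (I := I) p] with q hq
    simp only [hG q hq, Function.comp_apply, vectorInChart_extChartAt _ hq]
  have hm : mvfderiv I (fun q : N => G q (V q) (W q)) p (Z p)
      = fderiv ℝ (fun y => Γ y (vectorInChart I V p y) (vectorInChart I W p y))
          (extChartAt I p p) (Z p) := by
    have h1 := hf.mfderiv_eq (I := I) (I' := 𝓘(ℝ, ℝ))
    have h2 := mfderiv_comp p (I' := 𝓘(ℝ, F)) hd.mdifferentiableAt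
      (mdifferentiableAt_extChartAt (I := I) (mem_chart_source H p))
    rw [mfderiv_extChartAt_self, mfderiv_eq_fderiv, ← h1] at h2
    exact congrArg (fun L : F →L[ℝ] ℝ => L (Z p)) h2
  unfold lieDerivTensor
  rw [hm, hG p hp, hG p hp, mlieBracket_eq_lieBracket, mlieBracket_eq_lieBracket]
  congr 2
  · congr 1
    · exact tangentCoordChange_base p _
    · exact tangentCoordChange_base p _
  · exact tangentCoordChange_base p _
  · exact tangentCoordChange_base p _

end ChartRepresentation

/-! ### Components of (0,2)-tensors and their change of chart. -/

section TensorInChart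

variable {E : Type*} [NormedAddCommGroup E] [NormedSpace ℝ E]
  {M : Type*} [TopologicalSpace M] [ChartedSpace E M] [IsManifold 𝓘(ℝ, E) ∞ M]

local notation "φ" => extChartAt 𝓘(ℝ, E)
local notation "tc" => tangentCoordChange 𝓘(ℝ, E)

theorem contDiffAt_transition {x x₀ z : M} (hx : z ∈ (φ x).source) (hx₀ : z ∈ (φ x₀).source) :
    ContDiffAt ℝ ∞ (φ x₀ ∘ (φ x).symm) (φ x z) := by
  have := contDiffWithinAt_ext_coord_change (I := 𝓘(ℝ, E)) (n := ∞) x₀ x (y := φ x z)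
    (by rw [PartialEquiv.trans_source'', PartialEquiv.symm_symm, PartialEquiv.symm_target]
        exact mem_image_of_mem _ ⟨hx, hx₀⟩)
  rwa [ModelWithCorners.range_eq_univ, contDiffWithinAt_univ] at this

theorem hasFDerivAt_transition {x x₀ z : M} (hx : z ∈ (φ x).source) (hx₀ : z ∈ (φ x₀).source) :
    HasFDerivAt (φ x₀ ∘ (φ x).symm) (tc x x₀ z) (φ x z) := by
  have := hasFDerivWithinAt_tangentCoordChange (I := 𝓘(ℝ, E)) ⟨hx, hx₀⟩
  rwa [ModelWithCorners.range_eq_univ, hasFDerivWithinAt_univ] at this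

theorem mfderiv_extChartAt_symm_eq {x₀ x : M} (hx : x ∈ (φ x₀).source) :
    (mfderiv 𝓘(ℝ, E) 𝓘(ℝ, E) (φ x₀).symm (φ x₀ x) : E →L[ℝ] E) = tc x₀ x x := by
  rw [extChartAt_source] at hx
  have h := TangentBundle.symmL_trivializationAt (I := 𝓘(ℝ, E)) hx
  rw [ModelWithCorners.range_eq_univ, mfderivWithin_univ] at h
  exact h.symm.trans (TangentBundle.symmL_trivializationAt_eq_core hx)

variable (T : Π x : M, TangentSpace 𝓘(ℝ, E) x →L[ℝ] TangentSpace 𝓘(ℝ, E) x →L[ℝ] ℝ)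

theorem tensorInChart_extChartAt {x₀ x : M} (hx : x ∈ (φ x₀).source) (v w : E) :
    tensorInChart T x₀ (φ x₀ x) v w = T x (tc x₀ x x v) (tc x₀ x x w) := by
  have h (x' : M) (e : x' = x) (L : E →L[ℝ] E) (hL : L = tc x₀ x x) :
      T x' (L v) (L w) = T x (tc x₀ x x v) (tc x₀ x x w) := by
    subst e; rw [hL]
  exact h _ ((φ x₀).left_inv hx) _ (mfderiv_extChartAt_symm_eq hx)

theorem tangentCoordChange_cancel {x y z : M} (hx : z ∈ (φ x).source) (hy : z ∈ (φ y).source)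
    (v : E) : tc y x z (tc x y z v) = v := by
  rw [tangentCoordChange_comp ⟨⟨hx, hy⟩, hx⟩, tangentCoordChange_self hx]

theorem tensorInChart_tangentCoordChange {x x₀ z : M} (hx : z ∈ (φ x).source)
    (hx₀ : z ∈ (φ x₀).source) (v w : E) :
    tensorInChart T x₀ (φ x₀ z) (tc x x₀ z v) (tc x x₀ z w) = tensorInChart T x (φ x z) v w := by
  rw [tensorInChart_extChartAt T hx, tensorInChart_extChartAt T hx₀,
    tangentCoordChange_comp ⟨⟨hx, hx₀⟩, mem_extChartAt_source z⟩,
    tangentCoordChange_comp ⟨⟨hx, hx₀⟩, mem_extChartAt_source z⟩]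

theorem tensorInChart_base (x : M) (v w : TangentSpace 𝓘(ℝ, E) x) :
    tensorInChart T x (φ x x) v w = T x v w := by
  refine (tensorInChart_extChartAt T (mem_extChartAt_source x) v w).trans ?_
  have h := fun u : E => tangentCoordChange_base (I := 𝓘(ℝ, E)) x u
  exact congrArg₂ (fun a b : TangentSpace 𝓘(ℝ, E) x => T x a b) (h v) (h w)

theorem tensor_apply_eq_tensorInChart {x₀ x : M} (hx : x ∈ (φ x₀).source)
    (v w : TangentSpace 𝓘(ℝ, E) x) :
    T x v w = tensorInChart T x₀ (φ x₀ x) (tc x x₀ x v) (tc x x₀ x w) :=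
  ((tensorInChart_tangentCoordChange T (mem_extChartAt_source x) hx v w).trans
    (tensorInChart_base T x v w)).symm

/-- An identity of germs rather than of values, so that it can be differentiated; this is where
second derivatives of the transition map will come from. -/
theorem eventually_tensorInChart_transition {x₀ x : M} (hx : x ∈ (φ x₀).source) :
    ∀ᶠ y in 𝓝 (φ x x), tensorInChart T x y
      = (tensorInChart T x₀ ((φ x₀ ∘ (φ x).symm) y)).bilinearComp
          (fderiv ℝ (φ x₀ ∘ (φ x).symm) y) (fderiv ℝ (φ x₀ ∘ (φ x).symm) y) := by
  have h1 := extChartAt_target_mem_nhds (I := 𝓘(ℝ, E)) x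
  have h2 := (continuousAt_extChartAt_symm (I := 𝓘(ℝ, E)) x).preimage_mem_nhds
    (t := (φ x₀).source) (by rw [extChartAt_to_inv]; exact extChartAt_source_mem_nhds' hx)
  filter_upwards [h1, h2] with y hy hy'
  have hs := (φ x).map_target hy
  ext v w
  have hd := (hasFDerivAt_transition hs hy').fderiv
  have ht := tensorInChart_tangentCoordChange T hs hy' v w
  rw [(φ x).right_inv hy] at hd ht
  rw [ContinuousLinearMap.bilinearComp_apply, hd, Function.comp_apply, ht]

variable [FiniteDimensional ℝ E]

theorem contDiffOn_tensorInChart {T : Π x : M,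
      TangentSpace 𝓘(ℝ, E) x →L[ℝ] TangentSpace 𝓘(ℝ, E) x →L[ℝ] ℝ}
    (hT : IsSmoothTensor T) (x₀ : M) :
    ContDiffOn ℝ ∞ (tensorInChart T x₀) (φ x₀).target := by
  -- Coordinate fields of the chart at x₀ are smooth, being constant in the corresponding
  -- trivialization. In finite dimension, smoothness of T can be tested on them.
  have hsec (v : E) : ContMDiffOn 𝓘(ℝ, E) 𝓘(ℝ, E).tangent ∞
      (fun x : M => (⟨x, tc x₀ x x v⟩ : TangentBundle 𝓘(ℝ, E) M)) (φ x₀).source := by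
    intro x hx
    apply ContMDiffAt.contMDiffWithinAt
    refine ((trivializationAt E (TangentSpace 𝓘(ℝ, E)) x₀).contMDiffAt_section_iff
      (by rwa [extChartAt_source] at hx)).2 ?_
    refine (contMDiffAt_const (c := v)).congr_of_eventuallyEq ?_
    filter_upwards [extChartAt_source_mem_nhds' hx] with z hz
    exact tangentCoordChange_cancel hz (mem_extChartAt_source z) v
  refine contDiffOn_clm_apply.2 fun v => contDiffOn_clm_apply.2 fun w => ?_
  have hf : ContMDiffOn 𝓘(ℝ, E) 𝓘(ℝ, ℝ) ∞ (fun x : M => T x (tc x₀ x x v) (tc x₀ x x w))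
      (φ x₀).source := by
    intro x hx
    have := ContMDiffWithinAt.clm_bundle_apply₂ (F₁ := E) (F₂ := E) (F₃ := ℝ)
      (E₃ := fun _ : M => ℝ) (hT.contMDiffOn x hx) (hsec v x hx) (hsec w x hx)
    exact (contMDiffWithinAt_section (E := Trivial M ℝ)).1 this
  have hc := hf.comp (contMDiffOn_extChartAt_symm (I := 𝓘(ℝ, E)) (n := ∞) x₀)
    (fun y hy => (φ x₀).map_target hy)
  refine hc.contDiffOn.congr fun y hy => ?_
  have := tensorInChart_extChartAt T ((φ x₀).map_target hy) v w
  rwa [(φ x₀).right_inv hy] at this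

end TensorInChart

/-! ### Positive definite bilinear forms. -/

section BilinearForms

variable {E : Type*} [NormedAddCommGroup E] [NormedSpace ℝ E]

/-- Positivity gives injectivity of v ↦ B(v,·), and E and its dual have the same finite dimension.
-/
theorem bilinear_isInvertible_of_pos [FiniteDimensional ℝ E] {B : E →L[ℝ] E →L[ℝ] ℝ}
    (hB : ∀ v, v ≠ 0 → 0 < B v v) : B.IsInvertible := by
  have hinj : Function.Injective B.toLinearMap := by
    rw [injective_iff_map_eq_zero]
    intro v hv
    by_contra hne
    have h1 := hB v hne
    have h2 : B v = 0 := hv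
    rw [h2] at h1
    exact lt_irrefl _ h1
  have hdim : Module.finrank ℝ E = Module.finrank ℝ (E →L[ℝ] ℝ) := by
    rw [← (LinearMap.toContinuousLinearMap (𝕜 := ℝ) (E := E) (F' := ℝ)).finrank_eq]
    exact (Subspace.dual_finrank_eq (K := ℝ) (V := E)).symm
  exact ⟨(LinearEquiv.ofInjectiveOfFinrankEq B.toLinearMap hinj hdim).toContinuousLinearEquiv,
    by ext v w; rfl⟩

theorem eq_of_bilinear_eq_of_pos {B : E →L[ℝ] E →L[ℝ] ℝ} (hB : ∀ v, v ≠ 0 → 0 < B v v) {v w : E}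
    (h : ∀ z, B v z = B w z) : v = w := by
  by_contra hne
  have h1 := hB (v - w) (sub_ne_zero.2 hne)
  have h2 : B (v - w) (v - w) = 0 := by
    rw [map_sub B, sub_apply, h, sub_self]
  exact h1.ne' h2

end BilinearForms

set_option maxSynthPendingDepth 3

/-! ### Christoffel symbols in a fixed chart and their transformation law. -/

section Christoffel

variable {E : Type*} [NormedAddCommGroup E] [NormedSpace ℝ E]
  {M : Type*} [TopologicalSpace M] [ChartedSpace E M] [IsManifold 𝓘(ℝ, E) ∞ M]
  (g : ContMDiffRiemannianMetric 𝓘(ℝ, E) ∞ E (fun x : M => TangentSpace 𝓘(ℝ, E) x))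

local notation "φ" => extChartAt 𝓘(ℝ, E)
local notation "tc" => tangentCoordChange 𝓘(ℝ, E)

theorem isSmoothTensor_inner : IsSmoothTensor (M := M) g.inner := g.contMDiff

theorem metricInChart_pos (x₀ : M) {y : E} (hy : y ∈ (φ x₀).target) (v : E) (hv : v ≠ 0) :
    0 < tensorInChart g.inner x₀ y v v := by
  have hx := (φ x₀).map_target hy
  have h := tensorInChart_extChartAt (M := M) g.inner hx v v
  rw [(φ x₀).right_inv hy] at h
  rw [h]
  refine g.pos _ _ fun h0 => hv ?_
  have h1 := tangentCoordChange_cancel hx (mem_extChartAt_source (I := 𝓘(ℝ, E)) ((φ x₀).symm y)) v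
  rw [← h1]
  exact (congrArg _ h0).trans (map_zero _)

theorem metricInChart_symm (x₀ : M) {y : E} (hy : y ∈ (φ x₀).target) (v w : E) :
    tensorInChart g.inner x₀ y v w = tensorInChart g.inner x₀ y w v := by
  have hx := (φ x₀).map_target hy
  have h := tensorInChart_extChartAt (M := M) g.inner hx
  rw [(φ x₀).right_inv hy] at h
  rw [h, h]
  exact g.symm _ _ _

theorem fderiv_metricInChart_symm [FiniteDimensional ℝ E] (x₀ : M) {y : E}
    (hy : y ∈ (φ x₀).target) (u v w : E) :
    fderiv ℝ (tensorInChart g.inner x₀) y u v w = fderiv ℝ (tensorInChart g.inner x₀) y u w v := by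
  have hd : DifferentiableAt ℝ (tensorInChart g.inner x₀) y :=
    ((contDiffOn_tensorInChart (isSmoothTensor_inner g) x₀).contDiffAt
      ((isOpen_extChartAt_target x₀).mem_nhds hy)).differentiableAt (by simp)
  have h (a b : E) : fderiv ℝ (tensorInChart g.inner x₀) y u a b
      = fderiv ℝ (fun z => tensorInChart g.inner x₀ z a b) y u := by
    have h1 := (hd.hasFDerivAt.clm_apply (hasFDerivAt_const a y)).clm_apply (hasFDerivAt_const b y)
    rw [h1.fderiv]
    simp
  rw [h, h]
  have he : (fun z => tensorInChart g.inner x₀ z v w)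
      =ᶠ[𝓝 y] fun z => tensorInChart g.inner x₀ z w v := by
    filter_upwards [(isOpen_extChartAt_target x₀).mem_nhds hy] with z hz
      using metricInChart_symm g x₀ hz v w
  rw [he.fderiv_eq]

/-- The Christoffel symbols in the preferred chart around `x₀`, at the point with
coordinates `y`. -/
def christoffelInChart (x₀ : M) (y : E) : E →L[ℝ] E →L[ℝ] E :=
  let D := fderiv ℝ (tensorInChart g.inner x₀) y
  (ContinuousLinearMap.compL ℝ E (E →L[ℝ] ℝ) E (tensorInChart g.inner x₀ y).inverse) ∘L
    ((1 / 2 : ℝ) • (D + D.flip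
      - ((ContinuousLinearMap.flipₗᵢ ℝ E E ℝ).toContinuousLinearEquiv :
          (E →L[ℝ] E →L[ℝ] ℝ) →L[ℝ] (E →L[ℝ] E →L[ℝ] ℝ)) ∘L D.flip))

variable [FiniteDimensional ℝ E]

theorem metric_christoffelInChart (x₀ : M) {y : E} (hy : y ∈ (φ x₀).target) (v w z : E) :
    tensorInChart g.inner x₀ y (christoffelInChart g x₀ y v w) z
      = (1 / 2 : ℝ) * (fderiv ℝ (tensorInChart g.inner x₀) y v w z
        + fderiv ℝ (tensorInChart g.inner x₀) y w v z
        - fderiv ℝ (tensorInChart g.inner x₀) y z v w) := by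
  have hi := bilinear_isInvertible_of_pos (metricInChart_pos g x₀ hy)
  have h (α : E →L[ℝ] ℝ) : tensorInChart g.inner x₀ y ((tensorInChart g.inner x₀ y).inverse α) = α :=
    hi.self_apply_inverse α
  change tensorInChart g.inner x₀ y ((tensorInChart g.inner x₀ y).inverse _) z = _
  rw [h]
  rfl

/-- Metric compatibility: in the sum of the two Koszul formulas all but two equal terms cancel. -/
theorem metric_christoffelInChart_add (x₀ : M) {y : E} (hy : y ∈ (φ x₀).target) (v w z : E) :
    tensorInChart g.inner x₀ y (christoffelInChart g x₀ y v w) z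
      + tensorInChart g.inner x₀ y w (christoffelInChart g x₀ y v z)
      = fderiv ℝ (tensorInChart g.inner x₀) y v w z := by
  rw [metricInChart_symm g x₀ hy w, metric_christoffelInChart g x₀ hy,
    metric_christoffelInChart g x₀ hy, fderiv_metricInChart_symm g x₀ hy v z w,
    fderiv_metricInChart_symm g x₀ hy w v z, fderiv_metricInChart_symm g x₀ hy z v w]
  ring

/-- The connection is torsion-free because the Koszul expression is symmetric in its first two
arguments. -/
theorem christoffelInChart_symm (x₀ : M) {y : E} (hy : y ∈ (φ x₀).target) (v w : E) :
    christoffelInChart g x₀ y v w = christoffelInChart g x₀ y w v := by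
  refine eq_of_bilinear_eq_of_pos (metricInChart_pos g x₀ hy) fun z => ?_
  rw [metric_christoffelInChart g x₀ hy, metric_christoffelInChart g x₀ hy,
    fderiv_metricInChart_symm g x₀ hy z v w]
  ring

theorem contDiffOn_metricInChart_inverse (x₀ : M) :
    ContDiffOn ℝ ∞ (fun y => (tensorInChart g.inner x₀ y).inverse) (φ x₀).target := by
  have : CompleteSpace E := FiniteDimensional.complete ℝ E
  intro y hy
  exact (bilinear_isInvertible_of_pos (metricInChart_pos g x₀ hy)).contDiffAt_map_inverse
    |>.comp_contDiffWithinAt y (contDiffOn_tensorInChart (isSmoothTensor_inner g) x₀ y hy)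

theorem contDiffOn_christoffelInChart (x₀ : M) :
    ContDiffOn ℝ ∞ (christoffelInChart g x₀) (φ x₀).target := by
  have hD : ContDiffOn ℝ ∞ (fderiv ℝ (tensorInChart g.inner x₀)) (φ x₀).target :=
    (contDiffOn_tensorInChart (isSmoothTensor_inner g) x₀).fderiv_of_isOpen
      (isOpen_extChartAt_target x₀) (by simp)
  have hD' (a b c : E) :
      ContDiffOn ℝ ∞ (fun y => fderiv ℝ (tensorInChart g.inner x₀) y a b c) (φ x₀).target :=
    ((hD.clm_apply contDiffOn_const).clm_apply contDiffOn_const).clm_apply contDiffOn_const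
  refine contDiffOn_clm_apply.2 fun v => contDiffOn_clm_apply.2 fun w => ?_
  refine (contDiffOn_metricInChart_inverse g x₀).clm_apply (contDiffOn_clm_apply.2 fun z => ?_)
  exact (contDiffOn_const (c := (1 / 2 : ℝ))).mul (((hD' v w z).add (hD' w v z)).sub (hD' z v w))

theorem christoffel_eq_christoffelInChart (x : M) (v w : TangentSpace 𝓘(ℝ, E) x) :
    christoffel g x v w = christoffelInChart g x (φ x x) v w := by
  have hy := mem_extChartAt_target (I := 𝓘(ℝ, E)) x
  refine eq_of_bilinear_eq_of_pos (metricInChart_pos g x hy) fun z => ?_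
  exact ((tensorInChart_base (M := M) g.inner x _ _).trans (inner_christoffel g x v w z)).trans
    (metric_christoffelInChart g x hy v w z).symm

theorem fderiv_tensorInChart_transition {T : Π x : M,
      TangentSpace 𝓘(ℝ, E) x →L[ℝ] TangentSpace 𝓘(ℝ, E) x →L[ℝ] ℝ} (hT : IsSmoothTensor T)
    {x₀ x : M} (hx : x ∈ (φ x₀).source) (a v w : E) :
    fderiv ℝ (tensorInChart T x) (φ x x) a v w
      = fderiv ℝ (tensorInChart T x₀) (φ x₀ x) (tc x x₀ x a) (tc x x₀ x v) (tc x x₀ x w)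
        + tensorInChart T x₀ (φ x₀ x) (fderiv ℝ (fderiv ℝ (φ x₀ ∘ (φ x).symm)) (φ x x) a v)
            (tc x x₀ x w)
        + tensorInChart T x₀ (φ x₀ x) (tc x x₀ x v)
            (fderiv ℝ (fderiv ℝ (φ x₀ ∘ (φ x).symm)) (φ x x) a w) := by
  have hxs := mem_extChartAt_source (I := 𝓘(ℝ, E)) x
  have hτ := hasFDerivAt_transition hxs hx
  have hτ' : DifferentiableAt ℝ (fderiv ℝ (φ x₀ ∘ (φ x).symm)) (φ x x) :=
    ((contDiffAt_transition hxs hx).fderiv_right (m := ∞) (by simp)).differentiableAt (by simp)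
  have hd (x₁ : M) (h : x ∈ (φ x₁).source) :
      DifferentiableAt ℝ (tensorInChart T x₁) (φ x₁ x) :=
    ((contDiffOn_tensorInChart hT x₁).contDiffAt
      ((isOpen_extChartAt_target x₁).mem_nhds ((φ x₁).map_source h))).differentiableAt (by simp)
  have e0 : (φ x₀ ∘ (φ x).symm) (φ x x) = φ x₀ x := by
    rw [Function.comp_apply, extChartAt_to_inv]
  have h0 : HasFDerivAt (fun y => tensorInChart T x₀ ((φ x₀ ∘ (φ x).symm) y))
      ((fderiv ℝ (tensorInChart T x₀) (φ x₀ x)) ∘L tc x x₀ x) (φ x x) := by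
    have h00 : HasFDerivAt (tensorInChart T x₀) (fderiv ℝ (tensorInChart T x₀) (φ x₀ x))
        ((φ x₀ ∘ (φ x).symm) (φ x x)) := by
      rw [e0]
      exact (hd x₀ hx).hasFDerivAt
    exact h00.comp (φ x x) hτ
  have h1 (b : E) := hτ'.hasFDerivAt.clm_apply (hasFDerivAt_const b (φ x x))
  have h2 := (h0.clm_apply (h1 v)).clm_apply (h1 w)
  have h3 := ((hd x hxs).hasFDerivAt.clm_apply (hasFDerivAt_const v (φ x x))).clm_apply
    (hasFDerivAt_const w (φ x x))
  have he : (fun y => tensorInChart T x y v w) =ᶠ[𝓝 (φ x x)]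
      fun y => tensorInChart T x₀ ((φ x₀ ∘ (φ x).symm) y) (fderiv ℝ (φ x₀ ∘ (φ x).symm) y v)
        (fderiv ℝ (φ x₀ ∘ (φ x).symm) y w) := by
    filter_upwards [eventually_tensorInChart_transition T hx] with y hy
    rw [hy]
    rfl
  have h4 := congrArg (fun L : E →L[ℝ] ℝ => L a) (h3.unique (h2.congr_of_eventuallyEq he))
  simp only [hτ.fderiv, e0, add_apply, ContinuousLinearMap.comp_apply,
    ContinuousLinearMap.flip_apply, zero_apply, map_zero, zero_add] at h4
  rw [h4]
  ring

/-- Substituting the transformation of ∂g into the Koszul formula produces six terms with the second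
derivative of the transition map. By its symmetry four cancel and the other two coincide, which
absorbs the factor 1/2. -/
theorem tangentCoordChange_christoffel {x₀ x : M} (hx : x ∈ (φ x₀).source) (v w : E) :
    tc x x₀ x (christoffel g x v w)
      = christoffelInChart g x₀ (φ x₀ x) (tc x x₀ x v) (tc x x₀ x w)
        + fderiv ℝ (fderiv ℝ (φ x₀ ∘ (φ x).symm)) (φ x x) v w := by
  have hxs := mem_extChartAt_source (I := 𝓘(ℝ, E)) x
  have hy := (φ x₀).map_source hx
  have hsymm : IsSymmSndFDerivAt ℝ (φ x₀ ∘ (φ x).symm) (φ x x) :=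
    (contDiffAt_transition hxs hx).isSymmSndFDerivAt
      (by rw [minSmoothness_of_isRCLikeNormedField]; exact WithTop.coe_le_coe.2 (le_top : (2 : ℕ∞) ≤ ⊤))
  refine eq_of_bilinear_eq_of_pos (metricInChart_pos g x₀ hy) fun z' => ?_
  -- Coordinate changes are onto, so test vectors may be taken in the image.
  obtain ⟨z, rfl⟩ : ∃ z, tc x x₀ x z = z' := ⟨_, tangentCoordChange_cancel hx hxs z'⟩
  have h1 := tensorInChart_tangentCoordChange (M := M) g.inner hxs hx (christoffel g x v w) z
  rw [h1, (tensorInChart_base (M := M) g.inner x _ _).trans (inner_christoffel g x v w z),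
    fderiv_tensorInChart_transition (isSmoothTensor_inner g) hx,
    fderiv_tensorInChart_transition (isSmoothTensor_inner g) hx,
    fderiv_tensorInChart_transition (isSmoothTensor_inner g) hx, map_add,
    add_apply, metric_christoffelInChart g x₀ hy, hsymm.eq w v, hsymm.eq z v, hsymm.eq z w,
    metricInChart_symm g x₀ hy (tc x x₀ x w), metricInChart_symm g x₀ hy (tc x x₀ x v)]
  ring

end Christoffel

/-! ### The geometry of TM in induced charts. -/

section TangentBundleChart

variable {E : Type*} [NormedAddCommGroup E] [NormedSpace ℝ E]
  {M : Type*} [TopologicalSpace M] [ChartedSpace E M] [IsManifold 𝓘(ℝ, E) ∞ M]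

set_option maxSynthPendingDepth 3

local notation "φ" => extChartAt 𝓘(ℝ, E)
local notation "tc" => tangentCoordChange 𝓘(ℝ, E)
local notation "Φ" => extChartAt (ModelWithCorners.tangent 𝓘(ℝ, E))
local notation "tcT" => tangentCoordChange (ModelWithCorners.tangent 𝓘(ℝ, E))

theorem isSymmSndFDerivAt_transition {x₀ x : M} (hx : x ∈ (φ x₀).source) :
    IsSymmSndFDerivAt ℝ (φ x₀ ∘ (φ x).symm) (φ x x) :=
  (contDiffAt_transition (mem_extChartAt_source x) hx).isSymmSndFDerivAt
    (by rw [minSmoothness_of_isRCLikeNormedField]; exact WithTop.coe_le_coe.2 (le_top : (2 : ℕ∞) ≤ ⊤))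

theorem extChartAt_tangentBundle_base (p : TangentBundle 𝓘(ℝ, E) M) :
    Φ p p = @Prod.mk E E (φ p.1 p.1) p.2 :=
  Prod.ext rfl (tangentCoordChange_base (I := 𝓘(ℝ, E)) (F := E) p.1 p.2)

theorem mem_extChartAt_tangentBundle_source {p q : TangentBundle 𝓘(ℝ, E) M} :
    q ∈ (Φ p).source ↔ q.1 ∈ (φ p.1).source := by
  rw [extChartAt_source, extChartAt_source, TangentBundle.mem_chart_source_iff]

/-- The transition map of TM is (y,u) ↦ (τ(y), Dτ(y)u) with τ the transition map of M;
differentiating the second component gives the D²τ term. -/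
theorem tangentCoordChange_tangentBundle {p q : TangentBundle 𝓘(ℝ, E) M}
    (hq : q.1 ∈ (φ p.1).source) (ξ : E × E) :
    tcT q p q ξ = (tc q.1 p.1 q.1 ξ.1,
      fderiv ℝ (fderiv ℝ (φ p.1 ∘ (φ q.1).symm)) (φ q.1 q.1) ξ.1 q.2 + tc q.1 p.1 q.1 ξ.2) := by
  have hxs := mem_extChartAt_source (I := 𝓘(ℝ, E)) q.1
  have hqs := mem_extChartAt_source (I := ModelWithCorners.tangent 𝓘(ℝ, E)) q
  have hqp : q ∈ (Φ p).source := mem_extChartAt_tangentBundle_source.2 hq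
  let z₀ : E × E := (φ q.1 q.1, q.2)
  have hz₀ : Φ q q = z₀ := extChartAt_tangentBundle_base q
  have h1 : HasFDerivAt (Φ p ∘ (Φ q).symm) (tcT q p q) z₀ := by
    have := hasFDerivWithinAt_tangentCoordChange (I := ModelWithCorners.tangent 𝓘(ℝ, E)) ⟨hqs, hqp⟩
    rwa [ModelWithCorners.range_eq_univ, hasFDerivWithinAt_univ, hz₀] at this
  have he : (Φ p ∘ (Φ q).symm) =ᶠ[𝓝 z₀] fun z : E × E =>
      ((φ p.1 ∘ (φ q.1).symm) z.1, fderiv ℝ (φ p.1 ∘ (φ q.1).symm) z.1 z.2) := by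
    rw [← hz₀]
    have h1 := extChartAt_target_mem_nhds (I := ModelWithCorners.tangent 𝓘(ℝ, E)) q
    have h2 := (continuousAt_extChartAt_symm (I := ModelWithCorners.tangent 𝓘(ℝ, E))
      q).preimage_mem_nhds (t := (Φ p).source)
      (by rw [extChartAt_to_inv]; exact extChartAt_source_mem_nhds' hqp)
    filter_upwards [h1, h2] with z hz hz'
    have hr := (Φ q).map_target hz
    have hrz := (Φ q).right_inv hz
    change Φ p ((Φ q).symm z) = (φ p.1 ((φ q.1).symm z.1), fderiv ℝ (φ p.1 ∘ (φ q.1).symm) z.1 z.2)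
    have hrp : (Φ q).symm z ∈ (Φ p).source := hz'
    clear hz'
    -- Naming the point r of TM and replacing z by its coordinates removes the inverse chart from
    -- the goal.
    generalize (Φ q).symm z = r at hr hrz hrp
    subst hrz
    rw [mem_extChartAt_tangentBundle_source] at hr hrp
    refine Prod.ext (congrArg (φ p.1) ((φ q.1).left_inv hr)).symm ?_
    change tc r.1 p.1 r.1 r.2 = fderiv ℝ (φ p.1 ∘ (φ q.1).symm) (φ q.1 r.1) (tc r.1 q.1 r.1 r.2)
    rw [(hasFDerivAt_transition hr hrp).fderiv]
    exact (tangentCoordChange_comp ⟨⟨mem_extChartAt_source r.1, hr⟩, hrp⟩).symm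
  have hτ : HasFDerivAt (φ p.1 ∘ (φ q.1).symm) (tc q.1 p.1 q.1) z₀.1 := hasFDerivAt_transition hxs hq
  have hτ' : DifferentiableAt ℝ (fderiv ℝ (φ p.1 ∘ (φ q.1).symm)) z₀.1 :=
    ((contDiffAt_transition hxs hq).fderiv_right (m := ∞) (by simp)).differentiableAt (by simp)
  have h2 := (hτ.comp z₀ hasFDerivAt_fst).prodMk
    ((hτ'.hasFDerivAt.comp z₀ hasFDerivAt_fst).clm_apply hasFDerivAt_snd)
  have h3 := congrArg (fun L : E × E →L[ℝ] E × E => L ξ) ((h2.congr_of_eventuallyEq he).unique h1)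
  rw [← h3]
  refine Prod.ext rfl ?_
  simp only [ContinuousLinearMap.prod_apply, add_apply, ContinuousLinearMap.comp_apply,
    ContinuousLinearMap.flip_apply, hτ.fderiv, Function.comp_apply]
  exact add_comm _ _

variable (g : ContMDiffRiemannianMetric 𝓘(ℝ, E) ∞ E (fun x : M => TangentSpace 𝓘(ℝ, E) x))

/-- The connection map in the chart of the tangent bundle induced by the preferred chart
around `x₀`. -/
def connectionMapInChart (x₀ : M) (z ξ : E × E) : E :=
  ξ.2 + christoffelInChart g x₀ z.1 z.2 ξ.1

theorem tangentCoordChange_dproj {p q : TangentBundle 𝓘(ℝ, E) M} (hq : q ∈ (Φ p).source)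
    (ξ : TangentSpace 𝓘(ℝ, E).tangent q) :
    tc q.1 p.1 q.1 (dproj q ξ) = (tcT q p q ξ).1 := by
  rw [mem_extChartAt_tangentBundle_source] at hq
  exact (congrArg Prod.fst (tangentCoordChange_tangentBundle hq ξ)).symm

/-- The endomorphism `P_rᵃ` obtained by raising an index of a `(0,2)`-tensor field, in the
preferred chart around `x₀`. -/
def raisedTensorInChart
    (P : Π x : M, TangentSpace 𝓘(ℝ, E) x →L[ℝ] TangentSpace 𝓘(ℝ, E) x →L[ℝ] ℝ)
    (x₀ : M) (y : E) : E →L[ℝ] E :=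
  (tensorInChart g.inner x₀ y).inverse ∘L (tensorInChart P x₀ y).flip

variable [FiniteDimensional ℝ E]

/-- Both sides acquire the same term D²τ(ξ₁,u): the left from the inhomogeneous law for Γ, the right
from the coordinate change of TM. Thus K is tensorial although Γ is not. -/
theorem tangentCoordChange_connectionMap {p q : TangentBundle 𝓘(ℝ, E) M}
    (hq : q ∈ (Φ p).source) (ξ : TangentSpace 𝓘(ℝ, E).tangent q) :
    tc q.1 p.1 q.1 (connectionMap g q ξ) = connectionMapInChart g p.1 (Φ p q) (tcT q p q ξ) := by
  rw [mem_extChartAt_tangentBundle_source] at hq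
  have h := tangentCoordChange_tangentBundle hq ξ
  let u : E := q.2
  let ξ' : E × E := ξ
  let γ : E := christoffel g q.1 q.2 ξ'.1
  have h3 : tc q.1 p.1 q.1 γ = christoffelInChart g p.1 (φ p.1 q.1) (tc q.1 p.1 q.1 u)
        (tc q.1 p.1 q.1 ξ'.1)
      + fderiv ℝ (fderiv ℝ (φ p.1 ∘ (φ q.1).symm)) (φ q.1 q.1) ξ'.1 u := by
    rw [(isSymmSndFDerivAt_transition hq).eq ξ'.1]
    exact tangentCoordChange_christoffel g hq u ξ'.1
  have h4 : tc q.1 p.1 q.1 (connectionMap g q ξ) = tc q.1 p.1 q.1 (ξ'.2 + γ) := rfl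
  have h5 : connectionMapInChart g p.1 (Φ p q) (tcT q p q ξ)
      = (fderiv ℝ (fderiv ℝ (φ p.1 ∘ (φ q.1).symm)) (φ q.1 q.1) ξ'.1 u + tc q.1 p.1 q.1 ξ'.2)
        + christoffelInChart g p.1 (φ p.1 q.1) (tc q.1 p.1 q.1 u) (tc q.1 p.1 q.1 ξ'.1) :=
    congrArg (connectionMapInChart g p.1 (Φ p q)) h
  rw [h4, h5, map_add, h3]
  abel

variable {P : Π x : M, TangentSpace 𝓘(ℝ, E) x →L[ℝ] TangentSpace 𝓘(ℝ, E) x →L[ℝ] ℝ}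

variable (P) in
theorem metric_raisedTensorInChart (x₀ : M) {y : E} (hy : y ∈ (φ x₀).target) (v w : E) :
    tensorInChart g.inner x₀ y (raisedTensorInChart g P x₀ y v) w = tensorInChart P x₀ y w v :=
  congrArg (fun α : E →L[ℝ] ℝ => α w)
    ((bilinear_isInvertible_of_pos (metricInChart_pos g x₀ hy)).self_apply_inverse
      ((tensorInChart P x₀ y).flip v))

theorem contDiffOn_raisedTensorInChart (hP : IsSmoothTensor P) (x₀ : M) :
    ContDiffOn ℝ ∞ (raisedTensorInChart g P x₀) (φ x₀).target := by
  refine contDiffOn_clm_apply.2 fun v => ?_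
  have h : ContDiffOn ℝ ∞ (fun y => (tensorInChart P x₀ y).flip v) (φ x₀).target :=
    contDiffOn_clm_apply.2 fun w =>
      ((contDiffOn_tensorInChart hP x₀).clm_apply (contDiffOn_const (c := w))).clm_apply
        (contDiffOn_const (c := v))
  exact (contDiffOn_metricInChart_inverse g x₀).clm_apply h

variable (P) in
theorem tangentCoordChange_sharp {x₀ x : M} (hx : x ∈ (φ x₀).source) (u : TangentSpace 𝓘(ℝ, E) x) :
    tc x x₀ x (sharp g x (ContinuousLinearMap.flip (E := E) (F := E) (P x) u))
      = raisedTensorInChart g P x₀ (φ x₀ x) (tc x x₀ x u) := by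
  have hxs := mem_extChartAt_source (I := 𝓘(ℝ, E)) x
  have hy := (φ x₀).map_source hx
  refine eq_of_bilinear_eq_of_pos (metricInChart_pos g x₀ hy) fun z' => ?_
  obtain ⟨z, rfl⟩ : ∃ z, tc x x₀ x z = z' := ⟨_, tangentCoordChange_cancel hx hxs z'⟩
  rw [metric_raisedTensorInChart g P x₀ hy]
  have h1 := tensor_apply_eq_tensorInChart (M := M) g.inner hx
    (sharp g x (ContinuousLinearMap.flip (E := E) (F := E) (P x) u)) z
  have h2 := tensor_apply_eq_tensorInChart (M := M) P hx z u
  exact (h1.symm.trans (inner_sharp g x _ z)).trans h2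

variable (P) in
-- For a vertical vector the D²τ term vanishes, so only the tensorial transformation of S remains.
theorem vectorInChart_iotaLift {p : TangentBundle 𝓘(ℝ, E) M} {z : E × E} (hz : z ∈ (Φ p).target) :
    vectorInChart 𝓘(ℝ, E).tangent (iotaLift g P) p z
      = (0, raisedTensorInChart g P p.1 z.1 z.2) := by
  have hr := (Φ p).map_target hz
  have hrz := (Φ p).right_inv hz
  unfold vectorInChart
  generalize (Φ p).symm z = q at hr hrz
  subst hrz
  rw [mem_extChartAt_tangentBundle_source] at hr
  refine (tangentCoordChange_tangentBundle hr _).trans ?_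
  refine Prod.ext (map_zero _) ?_
  refine Eq.trans ?_ (tangentCoordChange_sharp g P hr q.2)
  refine (congrArg₂ (fun a b : E => a + b) ?_ rfl).trans (zero_add _)
  exact (congrArg (fun L : E →L[ℝ] E => L q.2) (map_zero _)).trans rfl

theorem contMDiff_iotaLift (hP : IsSmoothTensor P) :
    ContMDiff 𝓘(ℝ, E).tangent 𝓘(ℝ, E).tangent.tangent ∞ (fun q : TangentBundle 𝓘(ℝ, E) M =>
      (⟨q, iotaLift g P q⟩ : TangentBundle 𝓘(ℝ, E).tangent (TangentBundle 𝓘(ℝ, E) M))) := by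
  intro p
  refine (contMDiffAt_section (E := TangentSpace (M := TangentBundle 𝓘(ℝ, E) M)
    𝓘(ℝ, E).tangent) p).2 ?_
  have hp := mem_extChartAt_source (I := 𝓘(ℝ, E)) p.1
  have hS : ContDiffAt ℝ ∞ (fun z : E × E => ((0 : E), raisedTensorInChart g P p.1 z.1 z.2))
      (Φ p p) := by
    have h1 : ContDiffAt ℝ ∞ (raisedTensorInChart g P p.1) (Φ p p).1 :=
      (contDiffOn_raisedTensorInChart g hP p.1).contDiffAt
        ((isOpen_extChartAt_target p.1).mem_nhds ((φ p.1).map_source hp))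
    exact contDiffAt_const.prodMk ((h1.comp (Φ p p) contDiffAt_fst).clm_apply contDiffAt_snd)
  have hc : ContMDiffAt 𝓘(ℝ, E).tangent 𝓘(ℝ, E × E) ∞
      ((fun z : E × E => ((0 : E), raisedTensorInChart g P p.1 z.1 z.2)) ∘ Φ p) p :=
    hS.contMDiffAt.comp p (contMDiffAt_extChartAt (n := ∞))
  refine hc.congr_of_eventuallyEq ?_
  filter_upwards [extChartAt_source_mem_nhds (I := 𝓘(ℝ, E).tangent) p] with q hq
  exact (vectorInChart_extChartAt (iotaLift g P) hq).symm.trans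
    (vectorInChart_iotaLift g P ((Φ p).map_source hq))

/-- The `g`-natural metric with `a₂ = b₂ = B = 0`, in the chart of the tangent bundle induced by
the preferred chart around `x₀`. -/
def naturalMetricInChart (c : NaturalCoefficients) (x₀ : M) (z ξ η : E × E) : ℝ :=
  let G := tensorInChart g.inner x₀ z.1
  let K := connectionMapInChart g x₀ z
  c.A (G z.2 z.2) * G ξ.1 η.1 + c.a₁ (G z.2 z.2) * G (K ξ) (K η)
    + c.b₁ (G z.2 z.2) * (G z.2 (K ξ) * G z.2 (K η))

theorem naturalMetric_eq_naturalMetricInChart {c : NaturalCoefficients}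
    (ha₂ : ∀ t : ℝ, 0 ≤ t → c.a₂ t = 0) (hb₂ : ∀ t : ℝ, 0 ≤ t → c.b₂ t = 0)
    (hB : ∀ t : ℝ, 0 ≤ t → c.B t = 0) {p q : TangentBundle 𝓘(ℝ, E) M} (hq : q ∈ (Φ p).source)
    (ξ η : TangentSpace 𝓘(ℝ, E).tangent q) :
    naturalMetric g c q ξ η = naturalMetricInChart g c p.1 (Φ p q) (tcT q p q ξ) (tcT q p q η) := by
  -- The coefficients are known to vanish only on [0,∞).
  have hr : 0 ≤ g.inner q.1 q.2 q.2 := by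
    by_cases h : q.2 = 0
    · rw [h, map_zero]
    · exact (g.pos q.1 q.2 h).le
  have hq' := mem_extChartAt_tangentBundle_source.1 hq
  rw [naturalMetric_apply, ha₂ _ hr, hb₂ _ hr, hB _ hr]
  have ht (v w : TangentSpace 𝓘(ℝ, E) q.1) := tensor_apply_eq_tensorInChart (M := M) g.inner hq' v w
  have hd (ζ : TangentSpace 𝓘(ℝ, E).tangent q) := tangentCoordChange_dproj hq ζ
  have hk (ζ : TangentSpace 𝓘(ℝ, E).tangent q) := tangentCoordChange_connectionMap g hq ζ
  let G := tensorInChart (M := M) g.inner p.1 (φ p.1 q.1)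
  have h1 := (ht _ _).trans (congrArg₂ (fun a b : E => G a b) (hd ξ) (hd η))
  have h2 := (ht _ _).trans (congrArg₂ (fun a b : E => G a b) (hk ξ) (hk η))
  have h3 (ζ : TangentSpace 𝓘(ℝ, E).tangent q) := (ht q.2 (connectionMap g q ζ)).trans
    (congrArg (fun b : E => G (tc q.1 p.1 q.1 q.2) b) (hk ζ))
  rw [h1, h2, h3, h3, ht q.2 q.2]
  simp only [zero_mul, add_zero]
  rfl

end TangentBundleChart

/-! ### Chain rules for coefficients defined on the half-line. -/

section Calculus

/-- On the zero section r = g(u,u) vanishes and only one-sided differentiability of the coefficient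
is available; since r stays nonnegative this suffices. -/
theorem differentiableAt_comp_of_contDiffOn_Ici {F : Type*} [NormedAddCommGroup F]
    [NormedSpace ℝ F] {a : ℝ → ℝ} (ha : ContDiffOn ℝ ∞ a (Ici 0)) {r : F → ℝ} {z : F}
    (hr : DifferentiableAt ℝ r z) (h0 : ∀ᶠ y in 𝓝 z, 0 ≤ r y) :
    DifferentiableAt ℝ (fun y => a (r y)) z := by
  have h1 : DifferentiableWithinAt ℝ (a ∘ r) {y | 0 ≤ r y} z :=
    ((ha.differentiableOn (by simp)) (r z) h0.self_of_nhds).comp z hr.differentiableWithinAt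
      fun _ hy => hy
  exact h1.differentiableAt h0

theorem hasDerivAt_zero_comp_of_contDiffOn_Ici {a : ℝ → ℝ} (ha : ContDiffOn ℝ ∞ a (Ici 0))
    {r : ℝ → ℝ} {t : ℝ} (hr : HasDerivAt r 0 t) (h0 : ∀ s, 0 ≤ r s) :
    HasDerivAt (fun s => a (r s)) 0 t := by
  have h1 := ((ha.differentiableOn (by simp)) (r t) (h0 t)).hasDerivWithinAt.comp t
    (hr.hasDerivWithinAt (s := univ)) (fun s _ => h0 s)
  rw [mul_zero, hasDerivWithinAt_univ] at h1
  exact h1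

theorem hasDerivAt_comp_line {F F' : Type*} [NormedAddCommGroup F]
    [NormedSpace ℝ F] [NormedAddCommGroup F'] [NormedSpace ℝ F'] {f : F → F'} {z : F}
    (hf : DifferentiableAt ℝ f z) (v : F) :
    HasDerivAt (fun t : ℝ => f (z + t • v)) (fderiv ℝ f z v) 0 := by
  have hline : HasDerivAt (fun t : ℝ => z + t • v) v 0 := by
    simpa using ((hasDerivAt_id (0 : ℝ)).smul_const v).const_add z
  have h1 : HasFDerivAt f (fderiv ℝ f z) (z + (0 : ℝ) • v) := by
    rw [zero_smul, add_zero]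
    exact hf.hasFDerivAt
  exact h1.comp_hasDerivAt (0 : ℝ) hline

end Calculus

/-! ### Vanishing of the Lie derivative. -/

section Killing

variable {E : Type*} [NormedAddCommGroup E] [NormedSpace ℝ E]

/-- The algebraic core: the derivative of a natural bilinear expression along the fibre curve
`t ↦ u + t S u` is compensated by the derivative of the vector field `(y, u) ↦ (0, S u)`. -/
theorem hasDerivAt_naturalForm {G : E →L[ℝ] E →L[ℝ] ℝ} {Γ : E →L[ℝ] E →L[ℝ] E} {u s : E}
    {α β δ : ℝ → ℝ} (hα : HasDerivAt α 0 0) (hβ : HasDerivAt β 0 0) (hδ : HasDerivAt δ 0 0)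
    {V W : ℝ → E × E} {V' W' : E × E} (hV : HasDerivAt V V' 0) (hW : HasDerivAt W W' 0) :
    HasDerivAt (fun t : ℝ => α t * G (V t).1 (W t).1
      + β t * G ((V t).2 + Γ (u + t • s) (V t).1) ((W t).2 + Γ (u + t • s) (W t).1)
      + δ t * (G (u + t • s) ((V t).2 + Γ (u + t • s) (V t).1)
        * G (u + t • s) ((W t).2 + Γ (u + t • s) (W t).1)))
      (α 0 * (G V'.1 (W 0).1 + G (V 0).1 W'.1)
      + β 0 * (G (V'.2 + (Γ s (V 0).1 + Γ u V'.1)) ((W 0).2 + Γ u (W 0).1)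
        + G ((V 0).2 + Γ u (V 0).1) (W'.2 + (Γ s (W 0).1 + Γ u W'.1)))
      + δ 0 * ((G s ((V 0).2 + Γ u (V 0).1) + G u (V'.2 + (Γ s (V 0).1 + Γ u V'.1)))
          * G u ((W 0).2 + Γ u (W 0).1)
        + G u ((V 0).2 + Γ u (V 0).1)
          * (G s ((W 0).2 + Γ u (W 0).1) + G u (W'.2 + (Γ s (W 0).1 + Γ u W'.1))))) 0 := by
  have hu : HasDerivAt (fun t : ℝ => u + t • s) s 0 := by
    simpa using ((hasDerivAt_id (0 : ℝ)).smul_const s).const_add u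
  have hV1 : HasDerivAt (fun t => (V t).1) V'.1 0 := hV.fst
  have hV2 : HasDerivAt (fun t => (V t).2) V'.2 0 := hV.snd
  have hW1 : HasDerivAt (fun t => (W t).1) W'.1 0 := hW.fst
  have hW2 : HasDerivAt (fun t => (W t).2) W'.2 0 := hW.snd
  have hG {a b : ℝ → E} {a' b' : E} (ha : HasDerivAt a a' 0) (hb : HasDerivAt b b' 0) :
      HasDerivAt (fun t => G (a t) (b t)) (G a' (b 0) + G (a 0) b') 0 :=
    (G.hasFDerivAt.comp_hasDerivAt 0 ha).clm_apply hb
  have hΓ {a b : ℝ → E} {a' b' : E} (ha : HasDerivAt a a' 0) (hb : HasDerivAt b b' 0) :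
      HasDerivAt (fun t => Γ (a t) (b t)) (Γ a' (b 0) + Γ (a 0) b') 0 :=
    (Γ.hasFDerivAt.comp_hasDerivAt 0 ha).clm_apply hb
  have hKV := hV2.add (hΓ hu hV1)
  have hKW := hW2.add (hΓ hu hW1)
  have h := ((hα.mul (hG hV1 hW1)).add (hβ.mul (hG hKV hKW))).add
    (hδ.mul ((hG hu hKV).mul (hG hu hKW)))
  refine h.congr_deriv ?_
  simp only [zero_smul, add_zero, zero_mul, zero_add, Pi.add_apply]

variable {M : Type*} [TopologicalSpace M] [ChartedSpace E M] [IsManifold 𝓘(ℝ, E) ∞ M]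
  (g : ContMDiffRiemannianMetric 𝓘(ℝ, E) ∞ E (fun x : M => TangentSpace 𝓘(ℝ, E) x))
  [FiniteDimensional ℝ E]

set_option maxSynthPendingDepth 3

local notation "φ" => extChartAt 𝓘(ℝ, E)
local notation "Φ" => extChartAt (ModelWithCorners.tangent 𝓘(ℝ, E))

variable {P : Π x : M, TangentSpace 𝓘(ℝ, E) x →L[ℝ] TangentSpace 𝓘(ℝ, E) x →L[ℝ] ℝ}

theorem fderiv_tensorInChart_of_isParallel (hP : IsParallel g P) (x : M) (v w z : E) :
    fderiv ℝ (tensorInChart P x) (φ x x) v w z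
      = tensorInChart P x (φ x x) (christoffelInChart g x (φ x x) v w) z
        + tensorInChart P x (φ x x) w (christoffelInChart g x (φ x x) v z) := by
  have h := hP x v w z
  unfold covDerivTensor at h
  have h1 := (tensorInChart_base (M := M) P x (christoffel g x v w) z).symm.trans
    (congrArg (fun a : E => tensorInChart P x (φ x x) a z)
      (christoffel_eq_christoffelInChart g x v w))
  have h2 := (tensorInChart_base (M := M) P x w (christoffel g x v z)).symm.trans
    (congrArg (fun a : E => tensorInChart P x (φ x x) w a)
      (christoffel_eq_christoffelInChart g x v z))
  rw [h1, h2] at h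
  linarith

/-- The endomorphism obtained by raising an index of a parallel tensor field is parallel. -/
theorem fderiv_raisedTensorInChart_of_isParallel (hP_smooth : IsSmoothTensor P)
    (hP : IsParallel g P) (x : M) (v u : E) :
    fderiv ℝ (raisedTensorInChart g P x) (φ x x) v u
      = raisedTensorInChart g P x (φ x x) (christoffelInChart g x (φ x x) v u)
        - christoffelInChart g x (φ x x) v (raisedTensorInChart g P x (φ x x) u) := by
  have hy := mem_extChartAt_target (I := 𝓘(ℝ, E)) x
  have hn := (isOpen_extChartAt_target (I := 𝓘(ℝ, E)) x).mem_nhds hy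
  have hS : DifferentiableAt ℝ (raisedTensorInChart g P x) (φ x x) :=
    ((contDiffOn_raisedTensorInChart g hP_smooth x).contDiffAt hn).differentiableAt (by simp)
  have hG : DifferentiableAt ℝ (tensorInChart g.inner x) (φ x x) :=
    ((contDiffOn_tensorInChart (isSmoothTensor_inner g) x).contDiffAt hn).differentiableAt (by simp)
  have hPd : DifferentiableAt ℝ (tensorInChart P x) (φ x x) :=
    ((contDiffOn_tensorInChart hP_smooth x).contDiffAt hn).differentiableAt (by simp)
  refine eq_of_bilinear_eq_of_pos (metricInChart_pos g x hy) fun w => ?_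
  have h1 := (hG.hasFDerivAt.clm_apply (hS.hasFDerivAt.clm_apply
    (hasFDerivAt_const u (φ x x)))).clm_apply (hasFDerivAt_const w (φ x x))
  have h2 := (hPd.hasFDerivAt.clm_apply (hasFDerivAt_const w (φ x x))).clm_apply
    (hasFDerivAt_const u (φ x x))
  -- The defining relation g(Su,w) = P(w,u) is differentiated; ∇g = 0 and ∇P = 0 then express both
  -- derivatives through Γ.
  have he : (fun y => tensorInChart g.inner x y (raisedTensorInChart g P x y u) w)
      =ᶠ[𝓝 (φ x x)] fun y => tensorInChart P x y w u := by
    filter_upwards [hn] with y hy using metric_raisedTensorInChart g P x hy u w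
  have h3 := congrArg (fun L : E →L[ℝ] ℝ => L v) (h1.unique (h2.congr_of_eventuallyEq he))
  simp only [add_apply, ContinuousLinearMap.comp_apply, ContinuousLinearMap.flip_apply,
    zero_apply, map_zero, zero_add] at h3
  rw [fderiv_tensorInChart_of_isParallel g hP, ← metric_christoffelInChart_add g x hy,
    metric_raisedTensorInChart g P x hy, ← metric_raisedTensorInChart g P x hy _ w] at h3
  rw [map_sub, sub_apply]
  linarith

theorem differentiableAt_naturalMetricInChart (c : NaturalCoefficients) (x : M) (u : E)
    {V W : E × E → E × E} (hV : DifferentiableAt ℝ V (φ x x, u))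
    (hW : DifferentiableAt ℝ W (φ x x, u)) :
    DifferentiableAt ℝ (fun z => naturalMetricInChart g c x z (V z) (W z)) (φ x x, u) := by
  have hy := mem_extChartAt_target (I := 𝓘(ℝ, E)) x
  have hn := (isOpen_extChartAt_target (I := 𝓘(ℝ, E)) x).mem_nhds hy
  have hG : DifferentiableAt ℝ (fun z : E × E => tensorInChart g.inner x z.1) (φ x x, u) :=
    DifferentiableAt.comp (g := tensorInChart (M := M) g.inner x) (φ x x, u)
      (((contDiffOn_tensorInChart (isSmoothTensor_inner g) x).contDiffAt hn).differentiableAt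
        (by simp)) differentiableAt_fst
  have hΓ : DifferentiableAt ℝ (fun z : E × E => christoffelInChart g x z.1) (φ x x, u) :=
    DifferentiableAt.comp (g := christoffelInChart g x) (φ x x, u)
      (((contDiffOn_christoffelInChart g x).contDiffAt hn).differentiableAt (by simp))
      differentiableAt_fst
  have hu : DifferentiableAt ℝ (Prod.snd : E × E → E) (φ x x, u) := differentiableAt_snd
  have hK {U : E × E → E × E} (hU : DifferentiableAt ℝ U (φ x x, u)) :
      DifferentiableAt ℝ (fun z => connectionMapInChart g x z (U z)) (φ x x, u) :=
    hU.snd.add ((hΓ.clm_apply hu).clm_apply hU.fst)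
  have hr : DifferentiableAt ℝ (fun z : E × E => tensorInChart g.inner x z.1 z.2 z.2)
      (φ x x, u) := (hG.clm_apply hu).clm_apply hu
  have hpos : ∀ᶠ z : E × E in 𝓝 (φ x x, u), 0 ≤ tensorInChart g.inner x z.1 z.2 z.2 := by
    filter_upwards [continuousAt_fst.preimage_mem_nhds hn] with z hz
    by_cases h : z.2 = 0
    · rw [h, map_zero]
    · exact (metricInChart_pos g x hz z.2 h).le
  have hA := differentiableAt_comp_of_contDiffOn_Ici (c.smooth_a₁.add c.smooth_a₃) hr hpos
  have ha := differentiableAt_comp_of_contDiffOn_Ici c.smooth_a₁ hr hpos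
  have hb := differentiableAt_comp_of_contDiffOn_Ici c.smooth_b₁ hr hpos
  exact ((hA.mul ((hG.clm_apply hV.fst).clm_apply hW.fst)).add
    (ha.mul ((hG.clm_apply (hK hV)).clm_apply (hK hW)))).add
    (hb.mul (((hG.clm_apply hu).clm_apply (hK hV)).mul ((hG.clm_apply hu).clm_apply (hK hW))))

/-- Since [Z,V] = DV·Z − DZ·V, the derivatives of V and W cancel. The variation of K along Z
together with DZ·V contributes exactly S(KV), and skewness gives g(SKV,KW) + g(KV,SKW) = 0 and
g(Su,KV) + g(u,SKV) = 0. -/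
theorem naturalMetricInChart_lieDeriv_eq_zero (c : NaturalCoefficients)
    (hP_smooth : IsSmoothTensor P)
    (hP_skew : ∀ (x : M) (v w : TangentSpace 𝓘(ℝ, E) x), P x v w = -P x w v)
    (hP : IsParallel g P) (x : M) (u : E) {Z V W : E × E → E × E}
    (hZ : Z =ᶠ[𝓝 (φ x x, u)] fun z => (0, raisedTensorInChart g P x z.1 z.2))
    (hV : DifferentiableAt ℝ V (φ x x, u)) (hW : DifferentiableAt ℝ W (φ x x, u)) :
    fderiv ℝ (fun z => naturalMetricInChart g c x z (V z) (W z)) (φ x x, u) (Z (φ x x, u))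
      - naturalMetricInChart g c x (φ x x, u) (VectorField.lieBracket ℝ Z V (φ x x, u))
          (W (φ x x, u))
      - naturalMetricInChart g c x (φ x x, u) (V (φ x x, u))
          (VectorField.lieBracket ℝ Z W (φ x x, u)) = 0 := by
  have hy := mem_extChartAt_target (I := 𝓘(ℝ, E)) x
  have hn := (isOpen_extChartAt_target (I := 𝓘(ℝ, E)) x).mem_nhds hy
  have hd := differentiableAt_naturalMetricInChart g c x u hV hW
  set z₀ : E × E := (φ x x, u) with hz₀
  have hS : DifferentiableAt ℝ (raisedTensorInChart g P x) (φ x x) :=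
    ((contDiffOn_raisedTensorInChart g hP_smooth x).contDiffAt hn).differentiableAt (by simp)
  set S : E →L[ℝ] E := raisedTensorInChart g P x (φ x x)
  set G : E →L[ℝ] E →L[ℝ] ℝ := tensorInChart g.inner x (φ x x) with hG_def
  set Γ : E →L[ℝ] E →L[ℝ] E := christoffelInChart g x (φ x x) with hΓ_def
  have hGS (a b : E) : G (S a) b = -G a (S b) := by
    rw [metricInChart_symm g x hy a, metric_raisedTensorInChart g P x hy,
      metric_raisedTensorInChart g P x hy]
    have h1 := tensorInChart_base (M := M) P x b a
    have h2 := tensorInChart_base (M := M) P x a b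
    exact h1.trans ((hP_skew x b a).trans (congrArg Neg.neg h2.symm))
  have hGpos (v : E) : 0 ≤ G v v := by
    by_cases h : v = 0
    · rw [h, map_zero]
    · exact (metricInChart_pos g x hy v h).le
  have hZ₀ : Z z₀ = (0, S u) := hZ.self_of_nhds
  -- Parallelism replaces DS by the commutator of S with Γ(ξ₁,·).
  have hZ' (ξ : E × E) : fderiv ℝ Z z₀ ξ = (0, S (Γ ξ.1 u) - Γ ξ.1 (S u) + S ξ.2) := by
    have h1 : HasFDerivAt (raisedTensorInChart g P x)
      (fderiv ℝ (raisedTensorInChart g P x) (φ x x)) z₀.1 := hS.hasFDerivAt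
    have h2 := (hasFDerivAt_const (0 : E) z₀).prodMk
      ((h1.comp z₀ hasFDerivAt_fst).clm_apply hasFDerivAt_snd)
    have h3 := h2.congr_of_eventuallyEq hZ
    rw [h3.fderiv]
    refine Prod.ext rfl ?_
    have h4 := fderiv_raisedTensorInChart_of_isParallel g hP_smooth hP x ξ.1 u
    change S ξ.2 + fderiv ℝ (raisedTensorInChart g P x) (φ x x) ξ.1 u = _
    rw [h4, add_comm]
  -- Skewness gives g(Su,u) = 0, so the coefficients have zero derivative in the direction of Z.
  have hr : HasDerivAt (fun t : ℝ => G (u + t • S u) (u + t • S u)) 0 0 := by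
    have hu : HasDerivAt (fun t : ℝ => u + t • S u) (S u) 0 := by
      simpa using ((hasDerivAt_id (0 : ℝ)).smul_const (S u)).const_add u
    refine ((G.hasFDerivAt.comp_hasDerivAt 0 hu).clm_apply hu).congr_deriv ?_
    simp only [zero_smul, add_zero, Function.comp_apply]
    rw [hGS]
    ring
  have hα := hasDerivAt_zero_comp_of_contDiffOn_Ici (c.smooth_a₁.add c.smooth_a₃) hr
    fun s => hGpos _
  have hβ := hasDerivAt_zero_comp_of_contDiffOn_Ici c.smooth_a₁ hr fun s => hGpos _
  have hδ := hasDerivAt_zero_comp_of_contDiffOn_Ici c.smooth_b₁ hr fun s => hGpos _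
  have hmain := hasDerivAt_naturalForm (G := G) (Γ := Γ) (u := u) (s := S u) hα hβ hδ
    (hasDerivAt_comp_line hV (0, S u))
    (hasDerivAt_comp_line hW (0, S u))
  -- Z is vertical, so its directional derivative sees only the line u + tSu in one fibre, along
  -- which g and Γ are constant.
  have hDeq := (hasDerivAt_comp_line hd (0, S u)).unique
    (hmain.congr_of_eventuallyEq (Eventually.of_forall fun t => by
      have e1 : (z₀ + t • ((0, S u) : E × E)).1 = φ x x := by simp [hz₀]
      have e2 : (z₀ + t • ((0, S u) : E × E)).2 = u + t • S u := rfl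
      simp only [naturalMetricInChart, connectionMapInChart, e1, e2]
      rfl))
  rw [hZ₀, hDeq]
  simp only [zero_smul, add_zero, VectorField.lieBracket, hZ', hZ₀]
  unfold naturalMetricInChart connectionMapInChart
  simp only [hz₀, Prod.fst_sub, Prod.snd_sub, sub_zero, ← hG_def, ← hΓ_def,
    NaturalCoefficients.A]
  have hΓs (a b : E) : Γ a b = Γ b a := christoffelInChart_symm g x hy a b
  -- K uses Γ(u,ξ₁) while DZ uses Γ(ξ₁,u); torsion-freeness makes these match.
  rw [hΓs (V (φ x x, u)).1 u, hΓs (W (φ x x, u)).1 u, hΓs (V (φ x x, u)).1 (S u),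
    hΓs (W (φ x x, u)).1 (S u)]
  simp only [map_add, map_sub, add_apply, sub_apply, hGS]
  ring

end Killing

end TangentBundleGeometry

end

theorem mainTheorem10
    {E : Type*} [NormedAddCommGroup E] [NormedSpace ℝ E] [FiniteDimensional ℝ E]
    {M : Type*} [TopologicalSpace M] [T2Space M] [ChartedSpace E M] [IsManifold 𝓘(ℝ, E) ∞ M]
    (g : ContMDiffRiemannianMetric 𝓘(ℝ, E) ∞ E (fun x : M => TangentSpace 𝓘(ℝ, E) x))
    (c : TangentBundleGeometry.NaturalCoefficients)
    (ha₂ : ∀ t : ℝ, 0 ≤ t → c.a₂ t = 0)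
    (hb₂ : ∀ t : ℝ, 0 ≤ t → c.b₂ t = 0)
    (hB : ∀ t : ℝ, 0 ≤ t → c.B t = 0)
    (P : Π x : M, TangentSpace 𝓘(ℝ, E) x →L[ℝ] TangentSpace 𝓘(ℝ, E) x →L[ℝ] ℝ)
    (hP_smooth : TangentBundleGeometry.IsSmoothTensor P)
    (hP_skew : ∀ (x : M) (v w : TangentSpace 𝓘(ℝ, E) x), P x v w = -P x w v)
    (hP_parallel : TangentBundleGeometry.IsParallel g P) :
    TangentBundleGeometry.IsKillingField 𝓘(ℝ, E).tangent
      (TangentBundleGeometry.naturalMetric g c)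
      (TangentBundleGeometry.iotaLift g P) := by
  open TangentBundleGeometry in
  refine ⟨contMDiff_iotaLift g hP_smooth, fun p V W hV hW => ?_⟩
  have hV' := differentiableAt_vectorInChart hV
  have hW' := differentiableAt_vectorInChart hW
  have ht := extChartAt_target_mem_nhds (I := 𝓘(ℝ, E).tangent) p
  have hb : extChartAt 𝓘(ℝ, E).tangent p p = @Prod.mk E E (extChartAt 𝓘(ℝ, E) p.1 p.1) p.2 :=
    extChartAt_tangentBundle_base p
  have hZ := Filter.eventuallyEq_of_mem ht
    fun z hz => vectorInChart_iotaLift g P (p := p) (z := z) hz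
  rw [hb] at hV' hW' hZ
  rw [lieDerivTensor_eq_chart (Γ := naturalMetricInChart g c p.1)
    (fun q hq => naturalMetric_eq_naturalMetricInChart g ha₂ hb₂ hB hq)
    (by rw [hb]; exact differentiableAt_naturalMetricInChart g c p.1 p.2 hV' hW')]
  have hfin := naturalMetricInChart_lieDeriv_eq_zero g c hP_smooth hP_skew hP_parallel p.1 p.2
    hZ hV' hW'
  -- At the centre of the chart the components of a field are its value, which returns the
  -- coordinate identity to the form required.
  have hbase (U : Π q : TangentBundle 𝓘(ℝ, E) M, TangentSpace 𝓘(ℝ, E).tangent q) :=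
    vectorInChart_base (I := 𝓘(ℝ, E).tangent) U p
  rw [← hb, hbase, hbase, hbase] at hfin
  exact hfin
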